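/- Let $H$ be the discrete Schrödinger operator $(H\psi)(n)=\psi(n-1)+\psi(n+1)+V(n)\psi(n)$ with a real potential $V$, acting either in $\ell^2(\mathbb Z)$ or, with the Dirichlet condition $\psi(0)=0$, in $\ell^2(\mathbb N)$, $\mathbb N=\{1,2,3,\dots\}$, on its natural domain $\{\psi\in\ell^2 : H\psi\in\ell^2\}$, on which it is self-adjoint. For $z\in\mathbb C$ put $A(n,z)=\begin{pmatrix} z-V(n)&-1\\1&0\end{pmatrix}$ and let $T(n,m;z)$ be the transfer matrix: $T(n,m;z)=A(n,z)A(n-1,z)\cdots A(m+1,z)$ if $n>m$, $T(n,n;z)=I$, and $T(n,m;z)=T(m,n;z)^{-1}$ if $n<m$. Let $\psi(t)=e^{-itH}\delta_1$, $\psi(t,n)=\langle\psi(t),\delta_n\rangle$, and for $T>0$, $p>0$ put $$a(n,T)=\frac1T\int_0^\infty e^{-2t/T}|\psi(t,n)|^2\,dt,\qquad \langle|X|^p\rangle(T)=\sum_n|n|^p a(n,T),\qquad \beta^-(p)=\liminf_{T\to+\infty}\frac{\log\langle|X|^p\rangle(T)}{\log T}.$$ Suppose that for some $E_0\in\mathbb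 R$, $\alpha\ge 0$ and some constant $C=C(E_0)$, $$\|T(n,m;E_0)\|\le C\,(|n|+|m|)^\alpha$$ for all $n,m\in\mathbb Z$ with $(n,m)\neq(0,0)$ (respectively, for all $n,m\ge1$ in the half-line case). Then for every $p>0$, $$\beta^-(p)\ \ge\ \frac{p-1-4\alpha}{1+\alpha}.$$ -/

import Mathlib

open Filter Topology

namespace OneEnergy

/-- `ψ` is the (strong) solution of the Schrödinger equation `i ∂ₜ ψ = A ψ`, `ψ(0) = ψ₀`: the curve
stays in the domain of the unbounded operator `A` and is differentiable in norm at every time.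
For self-adjoint `A` and `ψ₀` in its domain this is exactly `ψ(t) = exp (-i t A) ψ₀`. -/
structure IsSchrodingerSolution {E : Type*} [NormedAddCommGroup E] [NormedSpace ℂ E]
    (A : E →ₗ.[ℂ] E) (ψ₀ : E) (ψ : ℝ → E) : Prop where
  init : ψ 0 = ψ₀
  mem_domain : ∀ t, ψ t ∈ A.domain
  hasDerivAt : ∀ (t : ℝ) (h : ψ t ∈ A.domain), HasDerivAt ψ (-(Complex.I • A ⟨ψ t, h⟩)) t

theorem norm_exp_sub_le (y : ℝ) :
    ‖Complex.exp (Complex.I * y) - 1 - Complex.I * y‖ ≤ 2 * y ^ 2 := by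
  have hn : ‖Complex.I * (y : ℂ)‖ = |y| := by simp
  rcases le_total |y| 1 with h | h
  · have := Complex.norm_exp_sub_one_sub_id_le (x := Complex.I * y) (by rw [hn]; exact h)
    rw [hn, sq_abs] at this
    nlinarith [sq_nonneg y]
  · have h1 := Real.norm_exp_I_mul_ofReal_sub_one_le (x := y)
    have h2 := norm_sub_le (Complex.exp (Complex.I * y) - 1) (Complex.I * y)
    rw [hn] at h2
    rw [Real.norm_eq_abs] at h1
    nlinarith [sq_abs y]

/-- The function `exp (-i t x)` with `x = 1 / w - 3 i`, used in the functional calculus of the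
resolvent `w = (x + 3 i)⁻¹`. -/
noncomputable def phase (t : ℝ) (w : ℂ) : ℂ := Complex.exp (-(Complex.I * t) * (w⁻¹ - 3 * Complex.I))

theorem exists_solution_of_resolvent {E : Type*} [NormedAddCommGroup E] [InnerProductSpace ℂ E]
    [CompleteSpace E] (A : E →ₗ.[ℂ] E) (R : E →L[ℂ] E) (hn : star R * R = R * star R)
    (hres : star R - R = (6 * Complex.I) • (R * star R))
    (hdom : ∀ v, R v ∈ A.domain)
    (hA : ∀ v (h : R v ∈ A.domain), A ⟨R v, h⟩ = v - (3 * Complex.I) • R v) (v : E) :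
    ∃ ψ, IsSchrodingerSolution A (R (R v)) ψ := by
  have hN : IsStarNormal R := ⟨hn⟩
  have hspec : ∀ w ∈ spectrum ℂ R, w ≠ 0 → ∃ x : ℝ, w⁻¹ - 3 * Complex.I = x := by
    have h1 : cfc (fun w : ℂ => star w - w) R
        = cfc (fun w : ℂ => (6 * Complex.I) * (w * star w)) R := by
      rw [cfc_sub (fun w : ℂ => star w) (fun w => w) R, cfc_star_id (R := ℂ) R, cfc_id' ℂ R,
        cfc_const_mul (6 * Complex.I) (fun w : ℂ => w * star w) R,
        cfc_mul (fun w : ℂ => w) (fun w => star w) R, cfc_star_id (R := ℂ) R, cfc_id' ℂ R, hres]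
    intro w hw hw0
    have h2 := (eqOn_of_cfc_eq_cfc (R := ℂ) h1 (by fun_prop) (by fun_prop)) hw
    beta_reduce at h2
    refine ⟨(w⁻¹ - 3 * Complex.I).re, ?_⟩
    have hs0 : star w ≠ 0 := star_ne_zero.mpr hw0
    have h3 : w⁻¹ - (star w)⁻¹ = 6 * Complex.I := by
      field_simp
      linear_combination h2
    apply Complex.ext
    · simp
    · have h4 := congrArg Complex.im h3
      have h5 : (star w)⁻¹ = star (w⁻¹) := (star_inv₀ w).symm
      rw [h5] at h4
      simp only [Complex.sub_im, Complex.star_def, Complex.conj_im, Complex.mul_im] at h4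
      norm_num at h4
      simp only [Complex.sub_im, Complex.mul_im, Complex.ofReal_im]
      norm_num
      linarith
  have hphase : ∀ t, ∀ w ∈ spectrum ℂ R, w ≠ 0 → ‖phase t w‖ = 1 := by
    intro t w hw hw0
    obtain ⟨x, hx⟩ := hspec w hw hw0
    rw [phase, hx]
    have : -(Complex.I * (t : ℂ)) * x = ((-(t * x) : ℝ) : ℂ) * Complex.I := by push_cast; ring
    rw [this, Complex.norm_exp_ofReal_mul_I]
  have hc1 : ∀ t, ContinuousOn (fun w : ℂ => w * phase t w) (spectrum ℂ R) := by
    intro t w hw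
    by_cases hw0 : w = 0
    · subst hw0
      have : Tendsto (fun w : ℂ => w * phase t w) (𝓝[spectrum ℂ R] 0) (𝓝 0) := by
        rw [tendsto_zero_iff_norm_tendsto_zero]
        have h0 : Tendsto (fun w : ℂ => ‖w‖) (𝓝[spectrum ℂ R] 0) (𝓝 0) := by
          have : Tendsto (fun w : ℂ => ‖w‖) (𝓝 0) (𝓝 ‖(0 : ℂ)‖) := continuous_norm.tendsto 0
          rw [norm_zero] at this
          exact this.mono_left nhdsWithin_le_nhds
        refine squeeze_zero' (Eventually.of_forall fun _ => norm_nonneg _) ?_ h0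
        filter_upwards [self_mem_nhdsWithin] with w hw
        by_cases h : w = 0
        · simp [h]
        · rw [norm_mul, hphase t w hw h, mul_one]
      simpa [ContinuousWithinAt] using this
    · have : ContinuousAt (fun w : ℂ => w * phase t w) w := by
        unfold phase
        fun_prop (disch := assumption)
      exact this.continuousWithinAt
  have hc2 : ∀ t, ContinuousOn (fun w : ℂ => w * (w * phase t w)) (spectrum ℂ R) := fun t =>
    continuousOn_id.mul (hc1 t)
  let G : ℝ → E →L[ℂ] E := fun t => cfc (fun w : ℂ => w * phase t w) R
  let W : ℝ → E →L[ℂ] E := fun t => cfc (fun w : ℂ => w * (w * phase t w)) R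
  have hWG : ∀ t, W t = R * G t := by
    intro t
    simp only [W, G]
    rw [cfc_mul (fun w : ℂ => w) (fun w => w * phase t w) R (by fun_prop) (hc1 t), cfc_id' ℂ R]
  have hder : ∀ t, HasDerivAt W (-(Complex.I • (G t - (3 * Complex.I) • W t))) t := by
    intro t
    have hD : (-(Complex.I • (G t - (3 * Complex.I) • W t)) : E →L[ℂ] E)
        = cfc (fun w : ℂ => -(Complex.I * (w * phase t w - 3 * Complex.I * (w * (w * phase t w))))) R := by
      rw [cfc_neg _ R, cfc_const_mul Complex.I _ R (by
          exact (hc1 t).sub (continuousOn_const.mul (hc2 t))),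
        cfc_sub (fun w : ℂ => w * phase t w) (fun w => 3 * Complex.I * (w * (w * phase t w))) R
          (hc1 t) (continuousOn_const.mul (hc2 t)),
        cfc_const_mul (3 * Complex.I) _ R (hc2 t)]
    rw [hasDerivAt_iff_isLittleO_nhds_zero]
    have hb : ∀ h : ℝ, ‖W (t + h) - W t - h • (-(Complex.I • (G t - (3 * Complex.I) • W t)))‖
        ≤ 2 * (1 + 3 * ‖R‖) ^ 2 * ‖h ^ 2‖ := by
      intro h
      rw [hD]
      have hcD : ContinuousOn (fun w : ℂ => -(Complex.I * (w * phase t w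
          - 3 * Complex.I * (w * (w * phase t w))))) (spectrum ℂ R) :=
        (continuousOn_const.mul ((hc1 t).sub (continuousOn_const.mul (hc2 t)))).neg
      have : (h • cfc (fun w : ℂ => -(Complex.I * (w * phase t w
          - 3 * Complex.I * (w * (w * phase t w))))) R : E →L[ℂ] E)
          = cfc (fun w : ℂ => (h : ℂ) * -(Complex.I * (w * phase t w
          - 3 * Complex.I * (w * (w * phase t w))))) R := by
        rw [cfc_const_mul (h : ℂ) _ R hcD]
        ext v; simp
      rw [this]
      simp only [W]
      rw [← cfc_sub _ _ R (hc2 _) (hc2 _), ← cfc_sub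
        (fun w : ℂ => w * (w * phase (t + h) w) - w * (w * phase t w))
        (fun w : ℂ => (h : ℂ) * -(Complex.I * (w * phase t w
          - 3 * Complex.I * (w * (w * phase t w))))) R ((hc2 _).sub (hc2 _))
        (continuousOn_const.mul hcD)]
      apply norm_cfc_le (by positivity)
      intro w hw
      have hwR : ‖w‖ ≤ ‖R‖ := by
        have h1 := spectrum.norm_le_norm_mul_of_mem hw
        have h2 : ‖(1 : E →L[ℂ] E)‖ ≤ 1 := ContinuousLinearMap.norm_id_le
        nlinarith [norm_nonneg R]
      by_cases hw0 : w = 0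
      · simp [hw0]; positivity
      obtain ⟨x, hx⟩ := hspec w hw hw0
      have hadd : phase (t + h) w = phase t w * Complex.exp (Complex.I * ((-(h * x) : ℝ) : ℂ)) := by
        rw [phase, phase, hx, ← Complex.exp_add]; congr 1; push_cast; ring
      have hwx : w * x = 1 - 3 * Complex.I * w := by
        rw [← hx]; field_simp
      have key : w * (w * phase (t + h) w) - w * (w * phase t w) - (h : ℂ) * -(Complex.I * (w * phase t w
          - 3 * Complex.I * (w * (w * phase t w))))
          = w ^ 2 * phase t w * (Complex.exp (Complex.I * ((-(h * x) : ℝ) : ℂ)) - 1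
            - Complex.I * ((-(h * x) : ℝ) : ℂ)) := by
        rw [hadd]; push_cast
        linear_combination (-(h : ℂ) * Complex.I * w * phase t w) * hwx
      rw [key, norm_mul, norm_mul, hphase t w hw hw0, norm_pow, mul_one]
      have h1 := norm_exp_sub_le (-(h * x))
      have h2 : ‖w‖ * |x| ≤ 1 + 3 * ‖R‖ := by
        calc ‖w‖ * |x| = ‖w * x‖ := by simp
          _ = ‖1 - 3 * Complex.I * w‖ := by rw [hwx]
          _ ≤ ‖(1 : ℂ)‖ + ‖3 * Complex.I * w‖ := norm_sub_le _ _
          _ ≤ 1 + 3 * ‖R‖ := by simp; linarith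
      calc ‖w‖ ^ 2 * _ ≤ ‖w‖ ^ 2 * (2 * (-(h * x)) ^ 2) := by gcongr
        _ = 2 * (‖w‖ * |x|) ^ 2 * h ^ 2 := by rw [mul_pow, sq_abs]; ring
        _ ≤ 2 * (1 + 3 * ‖R‖) ^ 2 * ‖h ^ 2‖ := by
          rw [Real.norm_eq_abs, abs_of_nonneg (sq_nonneg h)]
          gcongr
    refine (Asymptotics.IsBigO.of_bound _ (Eventually.of_forall hb)).trans_isLittleO ?_
    simpa using Asymptotics.isLittleO_pow_id (𝕜 := ℝ) (n := 2) (by norm_num)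
  refine ⟨fun t => W t v, ?_, ?_, ?_⟩
  · have : W 0 = R * R := by
      simp only [W]
      have : (fun w : ℂ => w * (w * phase 0 w)) = fun w => w * w := by
        ext w; simp [phase]
      rw [this, cfc_mul (fun w : ℂ => w) (fun w => w) R, cfc_id' ℂ R]
    simp [this]
  · intro t
    simp only [hWG]
    exact hdom _
  · intro t h
    have h1 := ((ContinuousLinearMap.apply ℂ E v).restrictScalars ℝ).hasFDerivAt.comp_hasDerivAt t
      (hder t)
    have h2 : A ⟨W t v, h⟩ = G t v - (3 * Complex.I) • W t v := by
      have h3 := hA (G t v) (hdom _)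
      have h4 : W t v = R (G t v) := by rw [hWG]; rfl
      simp only [h4]
      exact h3
    simp only [h2]
    have h5 : (ContinuousLinearMap.restrictScalars ℝ ((ContinuousLinearMap.apply ℂ E) v))
        (-(Complex.I • (G t - (3 * Complex.I) • W t)))
        = -(Complex.I • (G t v - (3 * Complex.I) • W t v)) := by simp
    rw [h5] at h1
    exact h1

theorem solution_unique {E : Type*} [NormedAddCommGroup E] [InnerProductSpace ℂ E] (A : E →ₗ.[ℂ] E)
    (hsym : ∀ f g : A.domain, inner ℂ (A f) (g : E) = inner ℂ (f : E) (A g))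
    {ψ₀ : E} {ψ φ : ℝ → E}
    (hψ : IsSchrodingerSolution A ψ₀ ψ) (hφ : IsSchrodingerSolution A ψ₀ φ) : ψ = φ := by
  have hd : ∀ t, HasDerivAt (fun s => ‖ψ s - φ s‖ ^ 2) 0 t := by
    intro t
    set f : A.domain := ⟨ψ t, hψ.mem_domain t⟩ - ⟨φ t, hφ.mem_domain t⟩ with hf
    have h1 : HasDerivAt (fun s => ψ s - φ s) (-(Complex.I • A f)) t := by
      have h0 := (hψ.hasDerivAt t (hψ.mem_domain t)).sub (hφ.hasDerivAt t (hφ.mem_domain t))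
      have h00 : -(Complex.I • A f) = -(Complex.I • A ⟨ψ t, hψ.mem_domain t⟩)
          - -(Complex.I • A ⟨φ t, hφ.mem_domain t⟩) := by
        rw [hf, LinearPMap.map_sub, smul_sub]; abel
      rw [h00]
      exact h0
    let _ : InnerProductSpace ℝ E := InnerProductSpace.rclikeToReal ℂ E
    have h2 := h1.norm_sq
    convert h2 using 1
    have h3 : inner ℝ (ψ t - φ t) (-(Complex.I • A f))
        = RCLike.re (inner ℂ (ψ t - φ t) (-(Complex.I • A f))) := rfl
    have h4 : (f : E) = ψ t - φ t := rfl
    have h5 := hsym f f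
    rw [h3, ← h4, inner_neg_right, inner_smul_right]
    have h6 : (inner ℂ (f : E) (A f)).im = 0 := by
      have := inner_conj_symm (𝕜 := ℂ) (f : E) (A f)
      rw [h5] at this
      have := congrArg Complex.im this
      simp only [Complex.conj_im] at this
      linarith
    simp [h6]
  funext t
  have h1 := is_const_of_deriv_eq_zero (fun s => (hd s).differentiableAt) (fun s => (hd s).deriv) t 0
  simp only [hψ.init, hφ.init, sub_self, norm_zero] at h1
  have : ‖ψ t - φ t‖ = 0 := by
    have h2 : ‖ψ t - φ t‖ ^ 2 = 0 := by simpa using h1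
    exact pow_eq_zero_iff (two_ne_zero) |>.1 h2
  exact sub_eq_zero.1 (norm_eq_zero.1 this)

/-- The Hilbert space `ℓ²(S)`; `S` is `ℤ` or the half-line `{1, 2, 3, …}`. -/
abbrev L2 (S : Set ℤ) : Type := lp (fun _ : S => ℂ) 2

/-- Extension by zero of a function on `S` to `ℤ`. -/
noncomputable def zeroExt (S : Set ℤ) (f : S → ℂ) : ℤ → ℂ := Function.extend Subtype.val f 0

/-- The formal action `(Hf)(n) = f(n-1) + f(n+1) + V(n) f(n)` for `n ∈ S`, where `f` is set to zero
outside `S`. On `S = {1, 2, 3, …}` this is the Dirichlet condition `f(0) = 0`. -/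
noncomputable def action (S : Set ℤ) (V : ℤ → ℝ) (f : S → ℂ) : S → ℂ := fun n =>
  zeroExt S f (n - 1) + zeroExt S f (n + 1) + (V n : ℂ) * f n

theorem zeroExt_coe (S : Set ℤ) (f : S → ℂ) (n : S) : zeroExt S f n = f n :=
  Subtype.val_injective.extend_apply f 0 n

theorem zeroExt_of_notMem (S : Set ℤ) (f : S → ℂ) {m : ℤ} (h : m ∉ S) : zeroExt S f m = 0 := by
  rw [zeroExt, Function.extend_apply' _ _ _ (by rintro ⟨a, rfl⟩; exact h a.2)]; rfl

theorem zeroExt_add (S : Set ℤ) (f g : S → ℂ) (m : ℤ) :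
    zeroExt S (f + g) m = zeroExt S f m + zeroExt S g m := by
  by_cases h : m ∈ S
  · lift m to S using h
    simp only [zeroExt_coe, Pi.add_apply]
  · simp [zeroExt_of_notMem S _ h]

theorem zeroExt_smul (S : Set ℤ) (c : ℂ) (f : S → ℂ) (m : ℤ) :
    zeroExt S (c • f) m = c * zeroExt S f m := by
  by_cases h : m ∈ S
  · lift m to S using h
    simp only [zeroExt_coe, Pi.smul_apply, smul_eq_mul]
  · simp [zeroExt_of_notMem S _ h]

theorem action_add (S : Set ℤ) (V : ℤ → ℝ) (f g : S → ℂ) :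
    action S V (f + g) = action S V f + action S V g := by
  ext n; simp only [action, zeroExt_add, Pi.add_apply]; ring

theorem action_smul (S : Set ℤ) (V : ℤ → ℝ) (c : ℂ) (f : S → ℂ) :
    action S V (c • f) = c • action S V f := by
  ext n; simp only [action, zeroExt_smul, Pi.smul_apply, smul_eq_mul]; ring

/-- The discrete Schrödinger operator `H` on `ℓ²(S)` with an arbitrary (possibly unbounded) real
potential, on its natural domain `{f ∈ ℓ²(S) : Hf ∈ ℓ²(S)}`, on which it is self-adjoint. -/
noncomputable def schrodingerOp (S : Set ℤ) (V : ℤ → ℝ) : L2 S →ₗ.[ℂ] L2 S where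
  domain :=
    { carrier := {f | Memℓp (action S V f) 2}
      add_mem' := fun {f g} hf hg => by
        simpa only [Set.mem_ofPred_eq, lp.coeFn_add, action_add] using hf.add hg
      zero_mem' := by
        have := action_smul S V 0 0
        simp only [zero_smul] at this
        simp only [Set.mem_ofPred_eq, lp.coeFn_zero, this]
        exact zero_memℓp
      smul_mem' := fun c f hf => by
        simpa only [Set.mem_ofPred_eq, lp.coeFn_smul, action_smul] using hf.const_smul c }
  toFun :=
    { toFun := fun f => ⟨action S V f.1, f.2⟩
      map_add' := fun f g => lp.ext (action_add S V f.1 g.1)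
      map_smul' := fun c f => lp.ext (action_smul S V c f.1) }

theorem summable_zeroExt (S : Set ℤ) (f : L2 S) :
    HasSum (fun m : ℤ => ‖zeroExt S f m‖ ^ 2) (‖f‖ ^ 2) := by
  have h := lp.hasSum_norm (p := 2) (by simp) f
  simp only [ENNReal.toReal_ofNat, Real.rpow_ofNat] at h
  rw [← hasSum_extend_zero (Subtype.val_injective (p := (· ∈ S)))] at h
  convert h using 2 with m
  by_cases hm : m ∈ S
  · have := Subtype.val_injective.extend_apply (fun n : S => ‖f n‖ ^ 2) 0 (⟨m, hm⟩ : S)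
    have h2 := zeroExt_coe S f ⟨m, hm⟩
    simp only at this h2
    rw [this, h2]
  · rw [zeroExt_of_notMem S _ hm, Function.extend_apply' _ _ _ (by rintro ⟨a, rfl⟩; exact hm a.2)]
    simp

theorem shift_sum_le (S : Set ℤ) (k : ℤ) (f : L2 S) (s : Finset S) :
    ∑ i ∈ s, ‖zeroExt S f ((i : ℤ) + k)‖ ^ (2 : ENNReal).toReal ≤ ‖f‖ ^ (2 : ENNReal).toReal := by
  simp only [ENNReal.toReal_ofNat, Real.rpow_ofNat]
  have h := (Equiv.addRight k).hasSum_iff.2 (summable_zeroExt S f)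
  have := sum_le_hasSum (s.map (Function.Embedding.subtype _)) (fun _ _ => sq_nonneg _) h
  simpa using this

/-- The shift `(f(n + k))` of the extension by zero, restricted to `S`. -/
noncomputable def shift (S : Set ℤ) (k : ℤ) : L2 S →L[ℂ] L2 S :=
  LinearMap.mkContinuous
    { toFun := fun f => ⟨fun n => zeroExt S f ((n : ℤ) + k), memℓp_gen' (shift_sum_le S k f)⟩
      map_add' := fun f g => lp.ext (by ext n; exact zeroExt_add S f g _)
      map_smul' := fun c f => lp.ext (by ext n; exact zeroExt_smul S c f _) } 1
    (fun f => by
      rw [one_mul]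
      exact lp.norm_le_of_forall_sum_le (by simp) (norm_nonneg _) (shift_sum_le S k f))

theorem shift_apply (S : Set ℤ) (k : ℤ) (f : L2 S) (n : S) :
    shift S k f n = zeroExt S f ((n : ℤ) + k) := rfl

theorem norm_shift_le (S : Set ℤ) (k : ℤ) : ‖shift S k‖ ≤ 1 :=
  LinearMap.mkContinuous_norm_le _ zero_le_one _

theorem hasSum_inner_zeroExt (S : Set ℤ) (k : ℤ) (f g : L2 S) :
    HasSum (fun m : ℤ => inner ℂ (zeroExt S f (m + k)) (zeroExt S g m))
      (inner ℂ (shift S k f) g) := by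
  have h := lp.hasSum_inner (𝕜 := ℂ) (shift S k f) g
  rw [← hasSum_extend_zero (Subtype.val_injective (p := (· ∈ S)))] at h
  suffices e : (fun m : ℤ => inner ℂ (zeroExt S f (m + k)) (zeroExt S g m))
      = Function.extend Subtype.val (fun n : S => inner ℂ (shift S k f n) (g n)) 0 by
    rw [e]; exact h
  funext m
  by_cases hm : m ∈ S
  · have := Subtype.val_injective.extend_apply
      (fun n : S => inner ℂ (shift S k f n) (g n)) 0 (⟨m, hm⟩ : S)
    have h2 := zeroExt_coe S g ⟨m, hm⟩
    simp only at this h2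
    rw [this, h2, shift_apply]
  · rw [zeroExt_of_notMem S _ hm, Function.extend_apply' _ _ _ (by rintro ⟨a, rfl⟩; exact hm a.2)]
    simp

theorem inner_shift (S : Set ℤ) (k : ℤ) (f g : L2 S) :
    inner ℂ (shift S k f) g = inner ℂ f (shift S (-k) g) := by
  have h1 := hasSum_inner_zeroExt S k f g
  have h2 := hasSum_inner_zeroExt S (-k) g f
  have h3 := (Equiv.addRight k).hasSum_iff.2 h2
  have h4 := h3.map (starRingEnd ℂ) Complex.continuous_conj
  rw [inner_conj_symm] at h4
  refine h1.unique ?_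
  convert h4 using 2 with m
  simp only [Function.comp, Equiv.coe_addRight, add_neg_cancel_right]
  rw [inner_conj_symm]

/-- The free part `f(n-1) + f(n+1)` of the operator. -/
noncomputable def hop (S : Set ℤ) : L2 S →L[ℂ] L2 S := shift S (-1) + shift S 1

theorem hop_apply (S : Set ℤ) (f : L2 S) (n : S) :
    hop S f n = zeroExt S f (n - 1) + zeroExt S f (n + 1) := rfl

theorem norm_hop_le (S : Set ℤ) : ‖hop S‖ ≤ 2 :=
  (norm_add_le _ _).trans (by linarith [norm_shift_le S (-1), norm_shift_le S 1])

theorem inner_hop (S : Set ℤ) (f g : L2 S) : inner ℂ (hop S f) g = inner ℂ f (hop S g) := by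
  simp only [hop, add_apply, inner_add_left, inner_add_right]
  rw [inner_shift, inner_shift, neg_neg, add_comm]

theorem schrodingerOp_apply (S : Set ℤ) (V : ℤ → ℝ) (f : (schrodingerOp S V).domain) (n : S) :
    schrodingerOp S V f n = hop S f n + (V n : ℂ) * (f : L2 S) n := rfl

theorem schrodingerOp_symmetric (S : Set ℤ) (V : ℤ → ℝ) (f g : (schrodingerOp S V).domain) :
    inner ℂ (schrodingerOp S V f) (g : L2 S) = inner ℂ (f : L2 S) (schrodingerOp S V g) := by
  have h : inner ℂ (schrodingerOp S V f - hop S f) (g : L2 S)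
      = inner ℂ (f : L2 S) (schrodingerOp S V g - hop S g) := by
    rw [lp.inner_eq_tsum, lp.inner_eq_tsum]
    congr 1
    ext n
    rw [lp.coeFn_sub, lp.coeFn_sub, Pi.sub_apply, Pi.sub_apply, schrodingerOp_apply,
      schrodingerOp_apply]
    simp only [RCLike.inner_apply, add_sub_cancel_left, map_mul, Complex.conj_ofReal]
    ring
  rw [inner_sub_left, inner_sub_right, inner_hop] at h
  exact sub_left_injective h

theorem mul_sum_le (S : Set ℤ) (c : S → ℂ) (hc : ∀ n, ‖c n‖ ≤ 1 / 3) (f : L2 S) (s : Finset S) :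
    ∑ i ∈ s, ‖c i * f i‖ ^ (2 : ENNReal).toReal ≤ (1 / 3 * ‖f‖) ^ (2 : ENNReal).toReal := by
  have h := lp.sum_rpow_le_norm_rpow (p := 2) (by simp) f s
  simp only [ENNReal.toReal_ofNat, Real.rpow_ofNat] at h ⊢
  calc ∑ i ∈ s, ‖c i * f i‖ ^ 2 ≤ ∑ i ∈ s, (1 / 3) ^ 2 * ‖f i‖ ^ 2 := by
        gcongr with i _
        rw [norm_mul, mul_pow]
        gcongr
        exact hc i
    _ = (1 / 3) ^ 2 * ∑ i ∈ s, ‖f i‖ ^ 2 := by rw [Finset.mul_sum]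
    _ ≤ (1 / 3) ^ 2 * ‖f‖ ^ 2 := by gcongr
    _ = _ := by ring

/-- Multiplication by a function that is bounded by `1 / 3`. -/
noncomputable def mulOp (S : Set ℤ) (c : S → ℂ) (hc : ∀ n, ‖c n‖ ≤ 1 / 3) : L2 S →L[ℂ] L2 S :=
  LinearMap.mkContinuous
    { toFun := fun f => ⟨fun n => c n * f n, memℓp_gen' (mul_sum_le S c hc f)⟩
      map_add' := fun f g => lp.ext (by ext n; exact mul_add _ _ _)
      map_smul' := fun a f => lp.ext (by ext n; exact mul_left_comm _ _ _) } (1 / 3)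
    (fun f => lp.norm_le_of_forall_sum_le (by simp) (by positivity) (mul_sum_le S c hc f))

/-- Both resolvents `(H + σ 3 i)⁻¹`, `σ = ± 1`, exist as bounded operators. -/
theorem exists_resolvent (S : Set ℤ) (V : ℤ → ℝ) (σ : ℝ) (hσ : |σ| = 1) :
    ∃ R : L2 S →L[ℂ] L2 S, (∀ v, ∃ h : R v ∈ (schrodingerOp S V).domain,
      schrodingerOp S V ⟨R v, h⟩ = v - (σ * (3 * Complex.I)) • R v) ∧
      ∀ f : (schrodingerOp S V).domain,
        R (schrodingerOp S V f + (σ * (3 * Complex.I)) • (f : L2 S)) = f := by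
  set z : ℂ := σ * (3 * Complex.I) with hz
  have him : ∀ n : S, 3 ≤ ‖(V n : ℂ) + z‖ := fun n => by
    have h := Complex.abs_im_le_norm ((V n : ℂ) + z)
    have : ((V n : ℂ) + z).im = σ * 3 := by simp [hz]
    rw [this, abs_mul, hσ] at h
    norm_num at h
    exact h
  have hne : ∀ n : S, (V n : ℂ) + z ≠ 0 := fun n h => by
    have := him n
    rw [h, norm_zero] at this
    linarith
  have hc : ∀ n : S, ‖((V n : ℂ) + z)⁻¹‖ ≤ 1 / 3 := fun n => by
    rw [norm_inv, ← one_div]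
    exact one_div_le_one_div_of_le (by norm_num) (him n)
  set m : L2 S →L[ℂ] L2 S := mulOp S _ hc with hm
  have hmn : ∀ (f : L2 S) (n : S), ((V n : ℂ) + z) * m f n = f n := fun f n => by
    have : m f n = ((V n : ℂ) + z)⁻¹ * f n := rfl
    rw [this, mul_inv_cancel_left₀ (hne n)]
  have hnm : ‖m‖ ≤ 1 / 3 := LinearMap.mkContinuous_norm_le _ (by norm_num) _
  have hlt : ‖-(hop S * m)‖ < 1 := by
    rw [norm_neg]
    calc ‖hop S * m‖ ≤ ‖hop S‖ * ‖m‖ := norm_mul_le _ _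
      _ ≤ 2 * (1 / 3) := by gcongr; exact norm_hop_le S
      _ < 1 := by norm_num
  obtain ⟨u, hu⟩ := isUnit_one_sub_of_norm_lt_one hlt
  rw [sub_neg_eq_add] at hu
  set Q : L2 S →L[ℂ] L2 S := ↑u⁻¹ with hQ
  have hQ1 : (1 + hop S * m) * Q = 1 := by rw [← hu]; exact u.mul_inv
  have hQ2 : Q * (1 + hop S * m) = 1 := by rw [← hu]; exact u.inv_mul
  have hact : ∀ v, action S V (m (Q v)) = ⇑(v - z • m (Q v)) := fun v => by
    ext n
    have h1 : (Q v + hop S (m (Q v))) = v := DFunLike.congr_fun hQ1 v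
    have h2 := hmn (Q v) n
    have h3 : action S V (m (Q v)) n = hop S (m (Q v)) n + (V n : ℂ) * m (Q v) n := rfl
    have h4 : Q v n + hop S (m (Q v)) n = v n := by
      conv_rhs => rw [← h1]
      rfl
    rw [h3, lp.coeFn_sub, lp.coeFn_smul, Pi.sub_apply, Pi.smul_apply, smul_eq_mul]
    linear_combination h2 + h4
  refine ⟨m * Q, fun v => ⟨?_, ?_⟩, fun f => ?_⟩
  · change Memℓp (action S V (m (Q v))) 2
    rw [hact]
    exact lp.memℓp _
  · exact lp.ext (hact v)
  · set g : L2 S := schrodingerOp S V f + z • (f : L2 S) - hop S f with hg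
    have h1 : m g = f := by
      refine lp.ext (funext fun n => ?_)
      have h2 : m g n = ((V n : ℂ) + z)⁻¹ * g n := rfl
      have h3 : g n = ((V n : ℂ) + z) * (f : L2 S) n := by
        rw [hg, lp.coeFn_sub, lp.coeFn_add, lp.coeFn_smul, Pi.sub_apply, Pi.add_apply,
          schrodingerOp_apply, Pi.smul_apply, smul_eq_mul]
        ring
      rw [h2, h3, inv_mul_cancel_left₀ (hne n)]
    have h4 : schrodingerOp S V f + z • (f : L2 S) = (1 + hop S * m) g := by
      change _ = g + hop S (m g)
      rw [h1, hg]; abel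
    have h5 : Q ((1 + hop S * m) g) = g := DFunLike.congr_fun hQ2 g
    rw [h4]
    change m (Q _) = _
    rw [h5, h1]

theorem memℓp_of_finite_support (S : Set ℤ) (f : S → ℂ) (hf : (Function.support f).Finite) :
    Memℓp f 2 := (memℓp_zero hf).of_exponent_ge zero_le

theorem finite_support_action (S : Set ℤ) (V : ℤ → ℝ) (f : S → ℂ)
    (hf : (Function.support f).Finite) : (Function.support (action S V f)).Finite := by
  have h1 : (Function.support (zeroExt S f)).Finite := by
    refine (hf.image Subtype.val).subset fun m hm => ?_
    by_cases h : m ∈ S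
    · refine ⟨⟨m, h⟩, ?_, rfl⟩
      intro h0
      exact hm ((zeroExt_coe S f ⟨m, h⟩).trans h0)
    · exact absurd (zeroExt_of_notMem S f h) hm
  have h2 : ∀ k : ℤ, {n : S | zeroExt S f (n + k) ≠ 0}.Finite := fun k =>
    h1.preimage (f := fun n : S => (n : ℤ) + k)
      (fun a _ b _ hab => Subtype.ext (by simpa using hab))
  refine (((h2 (-1)).union (h2 1)).union hf).subset fun n hn => ?_
  by_contra hcon
  simp only [Set.mem_union, Set.mem_ofPred_eq, Function.mem_support, not_or, not_not] at hcon
  refine hn ?_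
  have h3 : zeroExt S f (n - 1) = 0 := hcon.1.1
  simp [action, h3, hcon.1.2, hcon.2]

theorem finite_support_delta (S : Set ℤ) :
    (Function.support fun n : S => if (n : ℤ) = 1 then (1 : ℂ) else 0).Finite := by
  refine Set.Subsingleton.finite fun a ha b hb => Subtype.ext ?_
  simp only [Function.mem_support, ne_eq, ite_eq_right_iff, one_ne_zero, imp_false, not_not] at ha hb
  rw [ha, hb]

/-- The initial state `δ₁`. -/
noncomputable def delta₁ (S : Set ℤ) : L2 S :=
  ⟨fun n => if (n : ℤ) = 1 then 1 else 0, memℓp_of_finite_support S _ (finite_support_delta S)⟩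

theorem exists_evolution (S : Set ℤ) (V : ℤ → ℝ) :
    ∃ ψ, IsSchrodingerSolution (schrodingerOp S V) (delta₁ S) ψ := by
  obtain ⟨R, hR, hR'⟩ := exists_resolvent S V 1 (by simp)
  obtain ⟨Q, hQ, hQ'⟩ := exists_resolvent S V (-1) (by simp)
  simp only [Complex.ofReal_one, one_mul, Complex.ofReal_neg, neg_mul] at hR hR' hQ hQ'
  choose hRd hRa using hR
  choose hQd hQa using hQ
  have hadj : star R = Q := by
    rw [ContinuousLinearMap.star_eq_adjoint]
    refine ((ContinuousLinearMap.eq_adjoint_iff Q R).2 fun u v => ?_).symm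
    have h := schrodingerOp_symmetric S V ⟨Q u, hQd u⟩ ⟨R v, hRd v⟩
    rw [hRa, hQa] at h
    simp only [inner_sub_left, inner_sub_right, inner_smul_left, inner_smul_right] at h
    simp [Complex.conj_ofNat] at h
    linear_combination -h
  have hdiff1 : ∀ v, Q v - R v = (6 * Complex.I) • R (Q v) := fun v => by
    have h := hR' (⟨Q v, hQd v⟩)
    rw [hQa] at h
    simp only [map_add, map_sub, map_smul, neg_smul, map_neg] at h
    rw [sub_eq_iff_eq_add]
    refine h.symm.trans ?_
    module
  have hdiff2 : ∀ v, Q v - R v = (6 * Complex.I) • Q (R v) := fun v => by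
    have h := hQ' (⟨R v, hRd v⟩)
    rw [hRa] at h
    simp only [map_add, map_sub, map_smul, neg_smul, map_neg] at h
    generalize Q (R v) = c at h ⊢
    rw [← h]
    module
  have h6 : (6 * Complex.I) ≠ 0 := by simp
  have hfin := finite_support_delta S
  have hd1 : delta₁ S ∈ (schrodingerOp S V).domain :=
    memℓp_of_finite_support S _ (finite_support_action S V _ hfin)
  set v₁ : L2 S := schrodingerOp S V ⟨_, hd1⟩ + (3 * Complex.I) • delta₁ S with hv₁
  have hd2 : v₁ ∈ (schrodingerOp S V).domain := by
    refine Submodule.add_mem _ ?_ (Submodule.smul_mem _ _ hd1)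
    exact memℓp_of_finite_support S _
      (finite_support_action S V _ (finite_support_action S V _ hfin))
  have h1 : R v₁ = delta₁ S := hR' ⟨_, hd1⟩
  have h2 := hR' ⟨_, hd2⟩
  have h3 := exists_solution_of_resolvent (schrodingerOp S V) R
    (by
      rw [hadj]
      ext1 v
      exact smul_right_injective _ h6 ((hdiff2 v).symm.trans (hdiff1 v)))
    (by rw [hadj]; ext1 v; exact hdiff1 v) hRd (fun v _ => hRa v)
    (schrodingerOp S V ⟨_, hd2⟩ + (3 * Complex.I) • v₁)
  rw [h2] at h3
  simpa only [h1] using h3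

theorem evolution_unique (S : Set ℤ) (V : ℤ → ℝ) {ψ φ : ℝ → L2 S}
    (hψ : IsSchrodingerSolution (schrodingerOp S V) (delta₁ S) ψ)
    (hφ : IsSchrodingerSolution (schrodingerOp S V) (delta₁ S) φ) : ψ = φ :=
  solution_unique _ (schrodingerOp_symmetric S V) hψ hφ

/-- The evolved state `ψ(t) = exp (-i t H) δ₁`. -/
noncomputable def evolution (S : Set ℤ) (V : ℤ → ℝ) : ℝ → L2 S :=
  Classical.choose (exists_evolution S V)

theorem evolution_spec (S : Set ℤ) (V : ℤ → ℝ) :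
    IsSchrodingerSolution (schrodingerOp S V) (delta₁ S) (evolution S V) :=
  Classical.choose_spec (exists_evolution S V)

/-- The time-averaged probability `a(n,T) = (1/T) ∫₀^∞ exp (-2t/T) |ψ(t,n)|² dt`. -/
noncomputable def avgProb (S : Set ℤ) (V : ℤ → ℝ) (n : S) (T : ℝ) : ENNReal :=
  ENNReal.ofReal (1 / T) * ∫⁻ t in Set.Ioi (0 : ℝ),
    ENNReal.ofReal (Real.exp (-2 * t / T) * ‖evolution S V t n‖ ^ 2)

/-- The time-averaged moment `⟨|X|^p⟩(T) = ∑ₙ |n|^p a(n,T)`, a priori possibly infinite. -/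
noncomputable def moment (S : Set ℤ) (V : ℤ → ℝ) (p T : ℝ) : ENNReal :=
  ∑' n : S, ENNReal.ofReal (|((n : ℤ) : ℝ)| ^ p) * avgProb S V n T

/-- The lower growth exponent `β⁻(p) = liminf_{T → ∞} log ⟨|X|^p⟩(T) / log T`, an extended real
number (with `log 0 = -∞` and `log ∞ = ∞`). -/
noncomputable def betaMinus (S : Set ℤ) (V : ℤ → ℝ) (p : ℝ) : EReal :=
  liminf (fun T : ℝ => ENNReal.log (moment S V p T) / ((Real.log T : ℝ) : EReal)) atTop

/-- The one-step matrix `A(n,z)`. -/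
noncomputable def stepMatrix (V : ℤ → ℝ) (z : ℂ) (n : ℤ) : Matrix (Fin 2) (Fin 2) ℂ :=
  !![z - (V n : ℂ), -1; 1, 0]

/-- The product `A(m+k,z) A(m+k-1,z) ⋯ A(m+1,z)`. -/
noncomputable def stepProd (V : ℤ → ℝ) (z : ℂ) (m : ℤ) : ℕ → Matrix (Fin 2) (Fin 2) ℂ
  | 0 => 1
  | k + 1 => stepMatrix V z (m + (k + 1)) * stepProd V z m k

/-- The transfer matrix `T(n,m;z)`: the product `A(n,z) ⋯ A(m+1,z)` for `n > m`, the identity for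
`n = m`, and `T(m,n;z)⁻¹` for `n < m`. -/
noncomputable def transfer (V : ℤ → ℝ) (n m : ℤ) (z : ℂ) : Matrix (Fin 2) (Fin 2) ℂ :=
  if m ≤ n then stepProd V z m (n - m).toNat else (stepProd V z n (m - n).toNat)⁻¹

/-- The operator norm of a `2 × 2` matrix with respect to the Euclidean norm on `ℂ²`. -/
noncomputable def matNorm (M : Matrix (Fin 2) (Fin 2) ℂ) : ℝ :=
  ‖Matrix.toEuclideanCLM (n := Fin 2) (𝕜 := ℂ) M‖

end OneEnergy

namespace OneEnergy

/-! For `w = 2/T - i E₀` the Laplace transform `u(n) = ∫₀^∞ e^{-wt} ψ(t,n) dt` equals `-i (H - z)⁻¹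
δ₁` at `z = i w = E₀ + 2i/T`, so it satisfies the eigenvalue recursion at `z` except for a source at
the site 1 (`laplaceAmplitude_eq`). By Cauchy–Schwarz in time, `a(n,T) ≥ (2/T²) |u(n)|²`
(`laplaceAmplitude_sq_le_avgProb`). This single complex energy suffices: no integration over
energies is needed.

The source prevents the Cauchy data of `u` from being small on both sides of the site 1. On `|n| ≤
2M` the transfer matrices at `E₀` are bounded by `B ~ M^α`. Variation of parameters treats `z - E₀`,
of size `2/T`, as a perturbation, which is harmless while `M^{1+α} ≲ T` (`vecNorm_cauchyData_le`).
The Cauchy data therefore lose at most a factor `2B` away from the source, and one of the blocks at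
distance `M` to `2M` carries mass `∑ |u(n)|² ≳ M^{1-2α}` (`exists_block_le_sum`).

Hence `⟨|X|^p⟩(T) ≳ T⁻² M^{p+1-2α}`, and `M ~ T^{1/(1+α)}` gives the exponent `(p+1-2α)/(1+α) - 2 =
(p-1-4α)/(1+α)`. -/

/-! ### Unitarity and the Laplace transform of the evolution -/

/-- Symmetry of `H` makes `⟨ψ, Hψ⟩` real, so `d/dt ‖ψ‖² = 2 Re ⟨ψ, -iHψ⟩` vanishes. Its use is to
bound the amplitudes uniformly in time, which makes the Laplace integrals converge. -/
theorem norm_evolution (S : Set ℤ) (V : ℤ → ℝ) (t : ℝ) : ‖evolution S V t‖ = ‖delta₁ S‖ := by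
  have hs := evolution_spec S V
  have hd : ∀ t, HasDerivAt (fun s => ‖evolution S V s‖ ^ 2) 0 t := by
    intro t
    set f : (schrodingerOp S V).domain := ⟨evolution S V t, hs.mem_domain t⟩ with hf
    have h1 := hs.hasDerivAt t (hs.mem_domain t)
    let _ : InnerProductSpace ℝ (L2 S) := InnerProductSpace.rclikeToReal ℂ (L2 S)
    have h2 := h1.norm_sq
    convert h2 using 1
    have h3 : inner ℝ (evolution S V t) (-(Complex.I • schrodingerOp S V f))
        = RCLike.re (inner ℂ (f : L2 S) (-(Complex.I • schrodingerOp S V f))) := rfl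
    have h6 : (inner ℂ (f : L2 S) (schrodingerOp S V f)).im = 0 := by
      have := inner_conj_symm (𝕜 := ℂ) (f : L2 S) (schrodingerOp S V f)
      rw [schrodingerOp_symmetric S V f f] at this
      have := congrArg Complex.im this
      simp only [Complex.conj_im] at this
      linarith
    rw [h3, inner_neg_right, inner_smul_right]
    simp [h6]
  have h1 := is_const_of_deriv_eq_zero (fun s => (hd s).differentiableAt) (fun s => (hd s).deriv) t 0
  simp only [hs.init] at h1
  exact (pow_left_inj₀ (norm_nonneg _) (norm_nonneg _) two_ne_zero).1 h1

/-- The value `ψ(t,m)` of the evolved state, extended by zero outside `S`. -/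
noncomputable def amplitude (S : Set ℤ) (V : ℤ → ℝ) (m : ℤ) (t : ℝ) : ℂ :=
  zeroExt S (evolution S V t) m

theorem norm_amplitude_le (S : Set ℤ) (V : ℤ → ℝ) (m : ℤ) (t : ℝ) :
    ‖amplitude S V m t‖ ≤ ‖delta₁ S‖ := by
  unfold amplitude
  by_cases h : m ∈ S
  · lift m to S using h
    rw [zeroExt_coe, ← norm_evolution S V t]
    exact lp.norm_apply_le_norm (by simp) _ _
  · rw [zeroExt_of_notMem S _ h, norm_zero]
    exact norm_nonneg _

theorem amplitude_coe (S : Set ℤ) (V : ℤ → ℝ) (n : S) (t : ℝ) :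
    amplitude S V n t = evolution S V t n := zeroExt_coe S _ n

/-- Evaluation at a site is a bounded functional, so norm differentiability passes to coordinates.
The extension by zero builds in the Dirichlet condition when a neighbour lies outside `S`. -/
theorem hasDerivAt_amplitude (S : Set ℤ) (V : ℤ → ℝ) (n : ℤ) (hn : n ∈ S) (t : ℝ) :
    HasDerivAt (amplitude S V n) (-(Complex.I * (amplitude S V (n - 1) t + amplitude S V (n + 1) t
      + (V n : ℂ) * amplitude S V n t))) t := by
  have hs := evolution_spec S V
  have h1 := hs.hasDerivAt t (hs.mem_domain t)
  have h2 := ((lp.evalCLM ℂ (fun _ : S => ℂ) 2 ⟨n, hn⟩).restrictScalars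
    ℝ).hasFDerivAt.comp_hasDerivAt t h1
  have h3 : amplitude S V n = fun t => evolution S V t ⟨n, hn⟩ :=
    funext fun t => amplitude_coe S V ⟨n, hn⟩ t
  have h4 : (V n : ℂ) * amplitude S V n t = (V n : ℂ) * evolution S V t ⟨n, hn⟩ := by rw [h3]
  rw [h4, h3]
  exact h2

theorem continuous_amplitude (S : Set ℤ) (V : ℤ → ℝ) (m : ℤ) : Continuous (amplitude S V m) := by
  by_cases h : m ∈ S
  · exact continuous_iff_continuousAt.2 fun t => (hasDerivAt_amplitude S V m h t).continuousAt
  · have : amplitude S V m = fun _ => 0 := funext fun t => zeroExt_of_notMem S _ h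
    rw [this]
    exact continuous_const

theorem integrableOn_exp_mul_amplitude (S : Set ℤ) (V : ℤ → ℝ) (m : ℤ) (w : ℂ) (hw : 0 < w.re) :
    MeasureTheory.IntegrableOn (fun t : ℝ => Complex.exp (-w * t) * amplitude S V m t)
      (Set.Ioi 0) := by
  refine (integrableOn_exp_mul_complex_Ioi (a := -w) (by simpa using hw) 0).mul_bdd
    (c := ‖delta₁ S‖) (continuous_amplitude S V m).aestronglyMeasurable ?_
  exact Eventually.of_forall (norm_amplitude_le S V m)

/-- The Laplace transform of `ψ(·,m)` at `w`. -/
noncomputable def laplaceAmplitude (S : Set ℤ) (V : ℤ → ℝ) (w : ℂ) (m : ℤ) : ℂ :=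
  ∫ t in Set.Ioi (0 : ℝ), Complex.exp (-w * t) * amplitude S V m t

theorem laplaceAmplitude_of_notMem (S : Set ℤ) (V : ℤ → ℝ) (w : ℂ) {m : ℤ} (h : m ∉ S) :
    laplaceAmplitude S V w m = 0 := by
  simp [laplaceAmplitude, amplitude, zeroExt_of_notMem S _ h]

/-- Integrate the derivative of `e^{-wt} ψ(t,n)` over `(0, ∞)`. The boundary term at infinity
vanishes because `ψ` is bounded and `Re w > 0`; the one at `0` is `δ₁(n)`, which becomes the source.
-/
theorem laplaceAmplitude_eq (S : Set ℤ) (V : ℤ → ℝ) (w : ℂ) (hw : 0 < w.re) (n : ℤ) (hn : n ∈ S) :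
    laplaceAmplitude S V w (n - 1) + laplaceAmplitude S V w (n + 1)
      + ((V n : ℂ) - Complex.I * w) * laplaceAmplitude S V w n
      = if n = 1 then -Complex.I else 0 := by
  have hi := fun m => integrableOn_exp_mul_amplitude S V m w hw
  have hder : ∀ t ∈ Set.Ioi (0 : ℝ), HasDerivAt
      (fun t : ℝ => Complex.exp (-w * t) * amplitude S V n t)
      (-w * (Complex.exp (-w * t) * amplitude S V n t)
        + -Complex.I * (Complex.exp (-w * t) * amplitude S V (n - 1) t
        + Complex.exp (-w * t) * amplitude S V (n + 1) t
        + (V n : ℂ) * (Complex.exp (-w * t) * amplitude S V n t))) t := by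
    intro t _
    have h1 : HasDerivAt (fun t : ℝ => Complex.exp (-w * t)) (Complex.exp (-w * t) * (-w * 1)) t :=
      ((Complex.ofRealCLM.hasDerivAt (x := t)).const_mul (-w)).cexp
    refine (h1.mul (hasDerivAt_amplitude S V n hn t)).congr_deriv ?_
    ring
  have htend : Tendsto (fun t : ℝ => Complex.exp (-w * t) * amplitude S V n t) atTop (𝓝 0) := by
    rw [tendsto_zero_iff_norm_tendsto_zero]
    have h0 : Tendsto (fun t : ℝ => Real.exp (-(w.re * t)) * ‖delta₁ S‖) atTop (𝓝 0) := by
      have := (Real.tendsto_exp_neg_atTop_nhds_zero.comp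
        (tendsto_id.const_mul_atTop hw)).mul_const ‖delta₁ S‖
      simpa using this
    refine squeeze_zero (fun _ => norm_nonneg _) (fun t => ?_) h0
    rw [norm_mul, Complex.norm_exp]
    have : (-w * (t : ℂ)).re = -(w.re * t) := by simp
    rw [this]
    gcongr
    exact norm_amplitude_le S V n t
  have hi1 : MeasureTheory.IntegrableOn (fun t : ℝ => Complex.exp (-w * t) * amplitude S V (n - 1) t
      + Complex.exp (-w * t) * amplitude S V (n + 1) t) (Set.Ioi 0) := (hi _).add (hi _)
  have hi2 : MeasureTheory.IntegrableOn (fun t : ℝ => Complex.exp (-w * t) * amplitude S V (n - 1) t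
      + Complex.exp (-w * t) * amplitude S V (n + 1) t
      + (V n : ℂ) * (Complex.exp (-w * t) * amplitude S V n t)) (Set.Ioi 0) :=
    hi1.add ((hi n).const_mul _)
  have h1 := MeasureTheory.integral_Ioi_of_hasDerivAt_of_tendsto
    (a := (0 : ℝ)) (f := fun t : ℝ => Complex.exp (-w * t) * amplitude S V n t)
    (by
      have := continuous_amplitude S V n
      exact Continuous.continuousWithinAt (by fun_prop)) hder
    (((hi n).const_mul _).add (hi2.const_mul _)) htend
  rw [MeasureTheory.integral_add ((hi n).const_mul _) (hi2.const_mul _),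
    MeasureTheory.integral_const_mul, MeasureTheory.integral_const_mul,
    MeasureTheory.integral_add hi1 ((hi n).const_mul _),
    MeasureTheory.integral_add (hi _) (hi _), MeasureTheory.integral_const_mul] at h1
  have h2 : amplitude S V n 0 = if n = 1 then 1 else 0 := by
    have := amplitude_coe S V ⟨n, hn⟩ 0
    rw [(evolution_spec S V).init] at this
    exact this
  have h3 : Complex.exp (-w * ((0 : ℝ) : ℂ)) = 1 := by simp
  rw [h2, h3] at h1
  change -w * laplaceAmplitude S V w n + -Complex.I * (laplaceAmplitude S V w (n - 1)
    + laplaceAmplitude S V w (n + 1) + (V n : ℂ) * laplaceAmplitude S V w n) = _ at h1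
  split_ifs at h1 ⊢ <;>
  linear_combination Complex.I * h1 + (laplaceAmplitude S V w (n - 1)
    + laplaceAmplitude S V w (n + 1) + (V n : ℂ) * laplaceAmplitude S V w n) * Complex.I_sq

/-! ### From the Laplace transform to the moments -/

/-- This is Jensen's inequality for the probability measure `c e^{-ct} dt` on `(0, ∞)`, obtained by
expanding the variance of `f`, whose mean is `c J`. -/
theorem sq_integral_exp_mul_le {f : ℝ → ℝ} {c K : ℝ} (hc : 0 < c) (hf : Continuous f)
    (hK : ∀ t, |f t| ≤ K) :
    c * (∫ t in Set.Ioi (0 : ℝ), Real.exp (-c * t) * f t) ^ 2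
      ≤ ∫ t in Set.Ioi (0 : ℝ), Real.exp (-c * t) * f t ^ 2 := by
  have hi : MeasureTheory.IntegrableOn (fun t : ℝ => Real.exp (-c * t)) (Set.Ioi 0) :=
    integrableOn_exp_mul_Ioi (by linarith) 0
  have hi1 : MeasureTheory.IntegrableOn (fun t : ℝ => Real.exp (-c * t) * f t) (Set.Ioi 0) :=
    hi.mul_bdd (c := K) hf.aestronglyMeasurable (Eventually.of_forall hK)
  have hi2 : MeasureTheory.IntegrableOn (fun t : ℝ => Real.exp (-c * t) * f t ^ 2) (Set.Ioi 0) :=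
    hi.mul_bdd (c := K ^ 2) (hf.pow 2).aestronglyMeasurable (Eventually.of_forall fun t => by
      rw [norm_pow]
      exact pow_le_pow_left₀ (norm_nonneg _) (hK t) 2)
  have he : ∫ t in Set.Ioi (0 : ℝ), Real.exp (-c * t) = c⁻¹ := by
    rw [integral_exp_mul_Ioi (by linarith)]
    simp [neg_div]
  set J := ∫ t in Set.Ioi (0 : ℝ), Real.exp (-c * t) * f t
  have h0 : 0 ≤ ∫ t in Set.Ioi (0 : ℝ), Real.exp (-c * t) * (f t - c * J) ^ 2 :=
    MeasureTheory.integral_nonneg fun t => by positivity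
  have h1 : (fun t : ℝ => Real.exp (-c * t) * (f t - c * J) ^ 2)
      = fun t => (Real.exp (-c * t) * f t ^ 2 + (-2 * c * J) * (Real.exp (-c * t) * f t))
        + (c * J) ^ 2 * Real.exp (-c * t) := by
    ext t; ring
  have hi3 : MeasureTheory.IntegrableOn (fun t : ℝ => Real.exp (-c * t) * f t ^ 2
      + (-2 * c * J) * (Real.exp (-c * t) * f t)) (Set.Ioi 0) := hi2.add (hi1.const_mul _)
  rw [h1, MeasureTheory.integral_add hi3 (hi.const_mul _),
    MeasureTheory.integral_add hi2 (hi1.const_mul _), MeasureTheory.integral_const_mul,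
    MeasureTheory.integral_const_mul, he] at h0
  have h2 : (c * J) ^ 2 * c⁻¹ = c * J ^ 2 := by field_simp
  rw [h2] at h0
  change 0 ≤ _ + -2 * c * J * J + _ at h0
  nlinarith

/-- The choice `Re w = 2/T` makes `|e^{-wt}|` exactly the weight in `a(n,T)`. The imaginary part of
`w` stays free and selects the energy. -/
theorem laplaceAmplitude_sq_le_avgProb (S : Set ℤ) (V : ℤ → ℝ) (n : S) {T : ℝ} (hT : 0 < T)
    (w : ℂ) (hw : w.re = 2 / T) :
    ENNReal.ofReal (2 / T ^ 2 * ‖laplaceAmplitude S V w n‖ ^ 2) ≤ avgProb S V n T := by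
  have hc : 0 < 2 / T := by positivity
  have hcont := (continuous_amplitude S V n).norm
  have h1 := sq_integral_exp_mul_le hc hcont (K := ‖delta₁ S‖)
    (fun t => by rw [abs_norm]; exact norm_amplitude_le S V n t)
  have h2 : ‖laplaceAmplitude S V w n‖
      ≤ ∫ t in Set.Ioi (0 : ℝ), Real.exp (-(2 / T) * t) * ‖amplitude S V n t‖ := by
    refine (MeasureTheory.norm_integral_le_integral_norm _).trans (le_of_eq ?_)
    congr 1
    ext t
    rw [norm_mul, Complex.norm_exp]
    simp [hw]
  have h3 : avgProb S V n T = ENNReal.ofReal (1 / T * ∫ t in Set.Ioi (0 : ℝ),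
      Real.exp (-(2 / T) * t) * ‖amplitude S V n t‖ ^ 2) := by
    rw [avgProb, ENNReal.ofReal_mul (by positivity),
      MeasureTheory.ofReal_integral_eq_lintegral_ofReal]
    · congr 3
      ext t
      rw [amplitude_coe]
      congr 3
      ring
    · exact (integrableOn_exp_mul_Ioi (a := -(2 / T)) (by linarith) 0).mul_bdd
        (c := ‖delta₁ S‖ ^ 2) (hcont.pow 2).aestronglyMeasurable (Eventually.of_forall fun t => by
          rw [norm_pow, norm_norm]
          exact pow_le_pow_left₀ (norm_nonneg _) (norm_amplitude_le S V n t) 2)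
    · exact Eventually.of_forall fun t => by positivity
  rw [h3]
  apply ENNReal.ofReal_le_ofReal
  calc 2 / T ^ 2 * ‖laplaceAmplitude S V w n‖ ^ 2
      = 1 / T * (2 / T * ‖laplaceAmplitude S V w n‖ ^ 2) := by ring
    _ ≤ 1 / T * (2 / T * (∫ t in Set.Ioi (0 : ℝ),
          Real.exp (-(2 / T) * t) * ‖amplitude S V n t‖) ^ 2) := by gcongr
    _ ≤ _ := by gcongr

theorem le_moment (S : Set ℤ) (V : ℤ → ℝ) {p T M : ℝ} (hp : 0 < p) (hT : 0 < T) (hM : 0 ≤ M)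
    (w : ℂ) (hw : w.re = 2 / T) (F : Finset ℤ) (hF : ∀ m ∈ F, m ∈ S ∧ M ≤ |(m : ℝ)|) :
    ENNReal.ofReal (M ^ p * (2 / T ^ 2) * ∑ m ∈ F, ‖laplaceAmplitude S V w m‖ ^ 2)
      ≤ moment S V p T := by
  classical
  rw [Finset.mul_sum, ENNReal.ofReal_sum_of_nonneg (fun _ _ => by positivity),
    ← Finset.sum_subtype_of_mem (p := (· ∈ S)) _ (fun m hm => (hF m hm).1)]
  refine (Finset.sum_le_sum fun n hn => ?_).trans (ENNReal.sum_le_tsum _)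
  rw [Finset.mem_subtype] at hn
  rw [mul_assoc, ENNReal.ofReal_mul (by positivity)]
  gcongr
  · exact (hF n hn).2
  · exact laplaceAmplitude_sq_le_avgProb S V n hT w hw

/-! ### Transfer matrices and variation of parameters -/

/-- The vector `(u(n+1), u(n))` of Cauchy data. -/
noncomputable def cauchyData (u : ℤ → ℂ) (n : ℤ) : Fin 2 → ℂ := ![u (n + 1), u n]

theorem stepMatrix_det (V : ℤ → ℝ) (z : ℂ) (n : ℤ) : (stepMatrix V z n).det = 1 := by
  simp [stepMatrix, Matrix.det_fin_two]

theorem transfer_add (V : ℤ → ℝ) (z : ℂ) (m : ℤ) (k : ℕ) :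
    transfer V (m + k) m z = stepProd V z m k := by
  simp [transfer]

theorem transfer_add_right (V : ℤ → ℝ) (z : ℂ) (m : ℤ) (k : ℕ) :
    transfer V m (m + k) z = (stepProd V z m k)⁻¹ := by
  -- For `k = 0` the definition of `transfer` takes its first branch, so the identity rests on `1⁻¹
  -- = 1`; only `k + 1` reaches the inverse branch.
  rcases k with _ | k
  · simp [transfer, stepProd]
  · have : ¬ (m + ((k + 1 : ℕ) : ℤ) ≤ m) := by push_cast; omega
    rw [transfer, if_neg this]
    simp

theorem transfer_succ_left (V : ℤ → ℝ) (z : ℂ) {m n : ℤ} (h : m ≤ n) :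
    transfer V (n + 1) m z = stepMatrix V z (n + 1) * transfer V n m z := by
  obtain ⟨k, rfl⟩ := Int.le.dest h
  have := transfer_add V z m (k + 1)
  push_cast at this
  rw [transfer_add, add_assoc, this, stepProd]

theorem transfer_succ_right (V : ℤ → ℝ) (z : ℂ) {m n : ℤ} (h : m ≤ n) :
    transfer V m (n + 1) z * stepMatrix V z (n + 1) = transfer V m n z := by
  obtain ⟨k, rfl⟩ := Int.le.dest h
  have := transfer_add_right V z m (k + 1)
  push_cast at this
  rw [transfer_add_right, add_assoc, this, stepProd, Matrix.mul_inv_rev,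
    Matrix.mul_assoc, Matrix.nonsing_inv_mul _ (by rw [stepMatrix_det]; exact isUnit_one),
    Matrix.mul_one]

theorem transfer_self (V : ℤ → ℝ) (z : ℂ) (n : ℤ) : transfer V n n z = 1 := by
  simp [transfer, stepProd]

/-- The step matrices at `z` and `E` differ only in the upper left entry, by `z - E`, so the error
involves only the value `u (n + 1)`. -/
theorem cauchyData_succ (V : ℤ → ℝ) (E z : ℂ) (u : ℤ → ℂ) (n : ℤ)
    (hu : u n + u (n + 2) + ((V (n + 1) : ℂ) - z) * u (n + 1) = 0) :
    cauchyData u (n + 1)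
      = (stepMatrix V E (n + 1)).mulVec (cauchyData u n) + (z - E) • ![u (n + 1), 0] := by
  ext i
  have h2 : n + 1 + 1 = n + 2 := by ring
  fin_cases i
  · simp [cauchyData, stepMatrix, h2]
    linear_combination hu
  · simp [cauchyData, stepMatrix]

theorem sum_Ioc_succ {M : Type*} [AddCommMonoid M] (f : ℤ → M) {m n : ℤ} (h : m ≤ n) :
    ∑ k ∈ Finset.Ioc m (n + 1), f k = ∑ k ∈ Finset.Ioc m n, f k + f (n + 1) := by
  have : Finset.Ioc m (n + 1) = insert (n + 1) (Finset.Ioc m n) := by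
    ext k; simp only [Finset.mem_Ioc, Finset.mem_insert]; omega
  rw [this, Finset.sum_insert (by simp), add_comm]

/-- Variation of parameters, to the right. -/
theorem cauchyData_eq_forward (V : ℤ → ℝ) (E z : ℂ) (u : ℤ → ℂ) {m n : ℤ} (h : m ≤ n)
    (hu : ∀ k ∈ Finset.Ioc m n, u (k - 1) + u (k + 1) + ((V k : ℂ) - z) * u k = 0) :
    cauchyData u n = (transfer V n m E).mulVec (cauchyData u m)
      + (z - E) • ∑ k ∈ Finset.Ioc m n, (transfer V n k E).mulVec ![u k, 0] := by
  induction n, h using Int.leInduction with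
  | base => simp [transfer_self]
  | succ n h ih =>
    have hr := hu (n + 1) (by simp; omega)
    rw [add_sub_cancel_right, add_assoc n 1 1, one_add_one_eq_two] at hr
    rw [cauchyData_succ V E z u n hr, ih fun k hk => hu k (by
      simp only [Finset.mem_Ioc] at hk ⊢; omega), sum_Ioc_succ _ h, transfer_self, Matrix.one_mulVec,
      transfer_succ_left V E h, Matrix.mulVec_add, Matrix.mulVec_smul, Matrix.mulVec_mulVec,
      Matrix.mulVec_sum, smul_add, add_assoc]
    congr 3
    refine Finset.sum_congr rfl fun k hk => ?_
    rw [Matrix.mulVec_mulVec, transfer_succ_left V E (Finset.mem_Ioc.1 hk).2]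

/-- Variation of parameters, to the left. -/
theorem cauchyData_eq_backward (V : ℤ → ℝ) (E z : ℂ) (u : ℤ → ℂ) {m n : ℤ} (h : m ≤ n)
    (hu : ∀ k ∈ Finset.Ioc m n, u (k - 1) + u (k + 1) + ((V k : ℂ) - z) * u k = 0) :
    cauchyData u m = (transfer V m n E).mulVec (cauchyData u n)
      - (z - E) • ∑ k ∈ Finset.Ioc m n, (transfer V m k E).mulVec ![u k, 0] := by
  induction n, h using Int.leInduction with
  | base => simp [transfer_self]
  | succ n h ih =>
    have hr := hu (n + 1) (by simp; omega)
    rw [add_sub_cancel_right, add_assoc n 1 1, one_add_one_eq_two] at hr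
    rw [cauchyData_succ V E z u n hr, sum_Ioc_succ _ h, Matrix.mulVec_add, Matrix.mulVec_mulVec,
      transfer_succ_right V E h, Matrix.mulVec_smul, smul_add]
    refine (ih fun k hk => hu k (by simp only [Finset.mem_Ioc] at hk ⊢; omega)).trans ?_
    abel

/-! ### Stability of Cauchy data near the energy `E` -/

/-- The Euclidean norm on `ℂ²`. -/
noncomputable def vecNorm (v : Fin 2 → ℂ) : ℝ := ‖WithLp.toLp 2 v‖

theorem vecNorm_mulVec_le (A : Matrix (Fin 2) (Fin 2) ℂ) (v : Fin 2 → ℂ) :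
    vecNorm (A.mulVec v) ≤ matNorm A * vecNorm v :=
  (Matrix.toEuclideanCLM (n := Fin 2) (𝕜 := ℂ) A).le_opNorm (WithLp.toLp 2 v)

theorem vecNorm_sq (a b : ℂ) : vecNorm ![a, b] ^ 2 = ‖a‖ ^ 2 + ‖b‖ ^ 2 := by
  simp [vecNorm, EuclideanSpace.norm_sq_eq]

theorem norm_left_le_vecNorm (a b : ℂ) : ‖a‖ ≤ vecNorm ![a, b] :=
  (sq_le_sq₀ (norm_nonneg _) (norm_nonneg _)).1 (by
    have := vecNorm_sq a b; unfold vecNorm at this; rw [this]; nlinarith [sq_nonneg ‖b‖])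

theorem norm_right_le_vecNorm (a b : ℂ) : ‖b‖ ≤ vecNorm ![a, b] :=
  (sq_le_sq₀ (norm_nonneg _) (norm_nonneg _)).1 (by
    have := vecNorm_sq a b; unfold vecNorm at this; rw [this]; nlinarith [sq_nonneg ‖a‖])

theorem vecNorm_add_smul_sum_le (A : Matrix (Fin 2) (Fin 2) ℂ) (v : Fin 2 → ℂ) (δ : ℂ)
    (s : Finset ℤ) (D : ℤ → Matrix (Fin 2) (Fin 2) ℂ) (u : ℤ → ℂ) {B : ℝ} (hA : matNorm A ≤ B)
    (hD : ∀ k ∈ s, matNorm (D k) ≤ B) :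
    vecNorm (A.mulVec v + δ • ∑ k ∈ s, (D k).mulVec ![u k, 0])
      ≤ B * vecNorm v + ‖δ‖ * B * ∑ k ∈ s, ‖u k‖ := by
  have h1 : vecNorm (A.mulVec v + δ • ∑ k ∈ s, (D k).mulVec ![u k, 0])
      ≤ vecNorm (A.mulVec v) + ‖δ‖ * ∑ k ∈ s, vecNorm ((D k).mulVec ![u k, 0]) := by
    unfold vecNorm
    rw [WithLp.toLp_add, WithLp.toLp_smul, WithLp.toLp_sum]
    refine (norm_add_le _ _).trans ?_
    rw [norm_smul]
    gcongr
    exact norm_sum_le _ _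
  have hu : ∀ k, vecNorm ![u k, 0] = ‖u k‖ := fun k => by
    refine (pow_left_inj₀ (norm_nonneg _) (norm_nonneg _) two_ne_zero).1 ?_
    exact (vecNorm_sq _ _).trans (by simp)
  refine h1.trans ?_
  rw [mul_assoc]
  gcongr
  · exact (vecNorm_mulVec_le _ _).trans (mul_le_mul_of_nonneg_right hA (norm_nonneg _))
  · rw [Finset.mul_sum]
    refine Finset.sum_le_sum fun k hk => (vecNorm_mulVec_le _ _).trans ?_
    rw [hu]
    gcongr
    exact hD k hk

/-- If the transfer matrices at the energy `E` are bounded by `B` on `[a, b]`, then solutions at a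
nearby `z` grow at most by a factor `2 B`. -/
theorem vecNorm_cauchyData_le (V : ℤ → ℝ) (E z : ℂ) (u : ℤ → ℂ) {a b : ℤ} {B : ℝ}
    (hu : ∀ k ∈ Finset.Ioc a b, u (k - 1) + u (k + 1) + ((V k : ℂ) - z) * u k = 0)
    (hB : ∀ n ∈ Finset.Icc a b, ∀ m ∈ Finset.Icc a b, matNorm (transfer V n m E) ≤ B)
    (hz : ‖z - E‖ * B * (b - a) ≤ 1 / 2) {n m : ℤ} (hn : n ∈ Finset.Icc a b)
    (hm : m ∈ Finset.Icc a b) :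
    vecNorm (cauchyData u n) ≤ 2 * B * vecNorm (cauchyData u m) := by
  -- Comparing `m` with the site `x` where the Cauchy data are largest replaces a Gronwall
  -- iteration: the perturbation contributes at most half of the maximum `X` and is absorbed on the
  -- left, giving `X ≤ 2 B vecNorm (cauchyData u m)`.
  obtain ⟨x, hx, hmax⟩ := Finset.exists_max_image (Finset.Icc a b)
    (fun k => vecNorm (cauchyData u k)) ⟨n, hn⟩
  have hB0 : 0 ≤ B := (norm_nonneg _).trans (hB n hn n hn)
  set X := vecNorm (cauchyData u x) with hX
  have hX0 : 0 ≤ X := norm_nonneg _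
  have hsum : ∀ s ⊆ Finset.Ioc a b, ∑ k ∈ s, ‖u k‖ ≤ (b - a) * X := fun s hs => by
    have hab : a ≤ b := (Finset.mem_Icc.1 hn).1.trans (Finset.mem_Icc.1 hn).2
    calc ∑ k ∈ s, ‖u k‖ ≤ ∑ k ∈ Finset.Ioc a b, ‖u k‖ :=
          Finset.sum_le_sum_of_subset_of_nonneg hs fun _ _ _ => norm_nonneg _
      _ ≤ ∑ k ∈ Finset.Ioc a b, X := Finset.sum_le_sum fun k hk =>
          (norm_right_le_vecNorm _ _).trans (hmax k (Finset.Ioc_subset_Icc_self hk))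
      _ = (b - a) * X := by
          rw [Finset.sum_const, Int.card_Ioc, nsmul_eq_mul]
          congr 1
          have : (((b - a).toNat : ℤ) : ℝ) = ((b - a : ℤ) : ℝ) := by
            rw [Int.toNat_of_nonneg (by omega)]
          push_cast at this
          exact this
  have hkey : X ≤ B * vecNorm (cauchyData u m) + ‖z - E‖ * B * ((b - a) * X) := by
    rw [Finset.mem_Icc] at hx hm
    rcases le_total m x with h | h
    · have hs : Finset.Ioc m x ⊆ Finset.Ioc a b := Finset.Ioc_subset_Ioc hm.1 hx.2
      have hXx : X = vecNorm (cauchyData u x) := hX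
      rw [cauchyData_eq_forward V E z u h fun k hk => hu k (hs hk)] at hXx
      refine hXx.trans_le <| (vecNorm_add_smul_sum_le _ _ _ _ _ _
        (hB x (Finset.mem_Icc.2 hx) m (Finset.mem_Icc.2 hm)) fun k hk =>
        hB x (Finset.mem_Icc.2 hx) k (Finset.Ioc_subset_Icc_self (hs hk))).trans ?_
      gcongr
      exact hsum _ hs
    · have hs : Finset.Ioc x m ⊆ Finset.Ioc a b := Finset.Ioc_subset_Ioc hx.1 hm.2
      have hXx : X = vecNorm (cauchyData u x) := hX
      rw [cauchyData_eq_backward V E z u h fun k hk => hu k (hs hk), sub_eq_add_neg, ← neg_smul]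
        at hXx
      rw [← norm_neg (z - E)]
      refine hXx.trans_le <| (vecNorm_add_smul_sum_le _ _ _ _ _ _
        (hB x (Finset.mem_Icc.2 hx) m (Finset.mem_Icc.2 hm)) fun k hk =>
        hB x (Finset.mem_Icc.2 hx) k (Finset.Ioc_subset_Icc_self (hs hk))).trans ?_
      gcongr
      exact hsum _ hs
  have h1 := hmax n hn
  have h2 : ‖z - E‖ * B * ((b - a) * X) ≤ 1 / 2 * X := by
    rw [← mul_assoc]
    gcongr
  linarith

/-- Lower bound for the `ℓ²` mass of a solution on a block of `M + 1` sites. -/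
theorem le_sum_norm_sq (u : ℤ → ℂ) (a : ℤ) (M : ℕ) {c : ℝ} (hc : 0 ≤ c)
    (h : ∀ n ∈ Finset.Ico a (a + M), c ≤ vecNorm (cauchyData u n)) :
    M * c ^ 2 ≤ 2 * ∑ n ∈ Finset.Icc a (a + M), ‖u n‖ ^ 2 := by
  have h1 : ∑ n ∈ Finset.Ico a (a + M), ‖u n‖ ^ 2 ≤ ∑ n ∈ Finset.Icc a (a + M), ‖u n‖ ^ 2 :=
    Finset.sum_le_sum_of_subset_of_nonneg Finset.Ico_subset_Icc_self fun _ _ _ => sq_nonneg _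
  -- Each site enters at most two Cauchy vectors, once as `u n` and once as `u (n + 1)`; this is the
  -- factor 2 in the conclusion.
  have h2 : ∑ n ∈ Finset.Ico a (a + M), ‖u (n + 1)‖ ^ 2
      ≤ ∑ n ∈ Finset.Icc a (a + M), ‖u n‖ ^ 2 := by
    change ∑ n ∈ Finset.Ico a (a + M), ‖u (addRightEmbedding 1 n)‖ ^ 2 ≤ _
    rw [← Finset.sum_map (Finset.Ico a (a + M)) (addRightEmbedding 1) fun n => ‖u n‖ ^ 2]
    refine Finset.sum_le_sum_of_subset_of_nonneg (fun k hk => ?_) fun _ _ _ => sq_nonneg _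
    simp only [Finset.mem_map, Finset.mem_Ico, addRightEmbedding_apply] at hk
    obtain ⟨j, hj, rfl⟩ := hk
    rw [Finset.mem_Icc]
    omega
  have h3 : M * c ^ 2 ≤ ∑ n ∈ Finset.Ico a (a + M), (‖u (n + 1)‖ ^ 2 + ‖u n‖ ^ 2) := by
    have : ((Finset.Ico a (a + M)).card : ℝ) = M := by simp
    rw [← this, ← nsmul_eq_mul]
    refine Finset.card_nsmul_le_sum _ _ _ fun n hn => ?_
    rw [← vecNorm_sq]
    exact pow_le_pow_left₀ hc (h n hn) 2
  rw [Finset.sum_add_distrib] at h3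
  linarith

/-! ### Mass of the Laplace transform far from the source -/

/-- Power-law bounded transfer matrices at the energy `E₀` keep the Laplace transform of the
evolution large on one of the two blocks `M ≤ |n| ≤ 2 M`. -/
theorem exists_block_le_sum (S : Set ℤ) (hS : S = Set.univ ∨ S = Set.Ici 1) (V : ℤ → ℝ)
    (E₀ α C : ℝ) (hα : 0 ≤ α)
    (hT : ∀ n ∈ S, ∀ m ∈ S, (n ≠ 0 ∨ m ≠ 0) →
      matNorm (transfer V n m (E₀ : ℂ)) ≤ C * (|(n : ℝ)| + |(m : ℝ)|) ^ α) :
    ∃ D > 0, ∃ c > 0, ∀ T : ℝ, 1 ≤ T → ∀ M : ℕ, 1 ≤ M → 8 * D * (M : ℝ) ^ (1 + α) ≤ T →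
      ∀ w : ℂ, w = ((2 / T : ℝ) : ℂ) - Complex.I * E₀ → ∃ F : Finset ℤ,
        (∀ m ∈ F, m ∈ S ∧ (M : ℝ) ≤ |(m : ℝ)|) ∧
        c * (M / ((M : ℝ) ^ α) ^ 2) ≤ ∑ m ∈ F, ‖laplaceAmplitude S V w m‖ ^ 2 := by
  have h4 : (1 : ℝ) ≤ 4 ^ α := Real.one_le_rpow (by norm_num) hα
  -- On `|n|, |m| ≤ 2M` the hypothesis gives `C (4M)^α ≤ D M^α`. The maximum with 1 also covers the
  -- excluded pair `(0, 0)`, where the transfer matrix is the identity.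
  set D : ℝ := max C 1 * 4 ^ α with hD
  -- `K` bounds `|V(1) - z|`, since `|z - E₀| = 2/T ≤ 2`.
  set K : ℝ := |V 1| + |E₀| + 2 with hK
  have hD1 : 1 ≤ D := one_le_mul_of_one_le_of_one_le (le_max_right _ _) h4
  have hK0 : 0 < K := by positivity
  -- If the Cauchy data at 1 have norm below `c₀`, then `|u(2)| + K |u(1)| < 1/2`, so the source
  -- equation forces `|u(0)| ≥ 1/2`.
  set c₀ : ℝ := 1 / (2 * (K + 1)) with hc₀
  have hc₀0 : 0 < c₀ := by positivity
  refine ⟨D, by linarith, c₀ ^ 2 / (8 * D ^ 2), by positivity, fun T hT1 M hM hMT w hw => ?_⟩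
  have hM1 : (1 : ℝ) ≤ M := by exact_mod_cast hM
  have hMα : (1 : ℝ) ≤ (M : ℝ) ^ α := Real.one_le_rpow hM1 hα
  have hwre : 0 < w.re := by
    have : w.re = 2 / T := by simp [hw]
    rw [this]; positivity
  set u := laplaceAmplitude S V w
  set z := Complex.I * w with hz
  have hzE : z - E₀ = ((2 / T : ℝ) : ℂ) * Complex.I := by
    rw [hz, hw]; linear_combination -(E₀ : ℂ) * Complex.I_sq
  have hzn : ‖z - E₀‖ = 2 / T := by
    rw [hzE, norm_mul, Complex.norm_I, mul_one, Complex.norm_real, Real.norm_eq_abs,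
      abs_of_pos (by positivity)]
  set B : ℝ := D * (M : ℝ) ^ α with hB
  have hB1 : 1 ≤ B := one_le_mul_of_one_le_of_one_le hD1 hMα
  -- An interval of length at most `2M` gives the perturbation size `4 D M^{1+α} / T`; the constant
  -- 8 in the assumption on `T` makes this at most `1/2`.
  have hsmall : 2 / T * B * (2 * M) ≤ 1 / 2 := by
    rw [Real.rpow_add (by linarith), Real.rpow_one] at hMT
    have : 2 / T * B * (2 * M) = 8 * D * (M * (M : ℝ) ^ α) / (2 * T) := by
      rw [hB]; field_simp; ring
    rw [this, div_le_iff₀ (by linarith)]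
    linarith
  have hBT : ∀ n ∈ S, ∀ m ∈ S, |(n : ℝ)| ≤ 2 * M → |(m : ℝ)| ≤ 2 * M →
      matNorm (transfer V n m (E₀ : ℂ)) ≤ B := by
    intro n hn m hm hnM hmM
    by_cases h : n ≠ 0 ∨ m ≠ 0
    · calc matNorm (transfer V n m (E₀ : ℂ)) ≤ C * (|(n : ℝ)| + |(m : ℝ)|) ^ α := hT n hn m hm h
        _ ≤ max C 1 * (4 * M) ^ α := by
          gcongr
          · exact le_max_left _ _
          · linarith
        _ = B := by rw [Real.mul_rpow (by norm_num) (by linarith), hB, hD, mul_assoc]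
    · push Not at h
      rw [h.1, h.2, transfer_self]
      have : matNorm 1 ≤ 1 := by
        unfold matNorm
        rw [map_one]
        exact ContinuousLinearMap.norm_id_le
      linarith
  -- Propagation uses the recursion only at sites of `Ioc a b`, so the source site 1 may be the left
  -- endpoint `a` but must not lie in the rest of the interval.
  have hprop : ∀ a b : ℤ, (∀ n ∈ Finset.Icc a b, n ∈ S ∧ |n| ≤ 2 * M) → b - a ≤ 2 * M →
      1 ∉ Finset.Ioc a b → ∀ m ∈ Finset.Icc a b, c₀ ≤ vecNorm (cauchyData u m) →
      ∀ n ∈ Finset.Icc a b, c₀ / (2 * B) ≤ vecNorm (cauchyData u n) := by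
    intro a b hab hlen h1 m hm hcm n hn
    rw [div_le_iff₀ (by linarith), mul_comm]
    have habs : ∀ n ∈ Finset.Icc a b, |(n : ℝ)| ≤ 2 * M := fun n hn => by
      exact_mod_cast (hab n hn).2
    refine hcm.trans (vecNorm_cauchyData_le V E₀ z u (fun k hk => ?_) (fun n hn m hm =>
      hBT n (hab n hn).1 m (hab m hm).1 (habs n hn) (habs m hm)) ?_ hm hn)
    · have := laplaceAmplitude_eq S V w hwre k (hab k (Finset.Ioc_subset_Icc_self hk)).1
      rwa [if_neg (by rintro rfl; exact h1 hk)] at this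
    · rw [hzn]
      refine le_trans ?_ hsmall
      gcongr
      exact_mod_cast hlen
  have hfinal : ∀ s : ℝ, M * (c₀ / (2 * B)) ^ 2 ≤ 2 * s →
      c₀ ^ 2 / (8 * D ^ 2) * (M / ((M : ℝ) ^ α) ^ 2) ≤ s := by
    intro s hs
    have : M * (c₀ / (2 * B)) ^ 2 = 2 * (c₀ ^ 2 / (8 * D ^ 2) * (M / ((M : ℝ) ^ α) ^ 2)) := by
      rw [hB]; field_simp; ring
    linarith
  have h1S : (1 : ℤ) ∈ S := by rcases hS with rfl | rfl <;> simp
  have hsrc : 1 ≤ ‖u 0‖ + ‖u 2‖ + K * ‖u 1‖ := by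
    have h := laplaceAmplitude_eq S V w hwre 1 h1S
    rw [if_pos rfl, sub_self, one_add_one_eq_two] at h
    have hK' : ‖(V 1 : ℂ) - z‖ ≤ K := by
      have e : (V 1 : ℂ) - z = (V 1 : ℂ) - (E₀ : ℂ) - (z - E₀) := by ring
      have h2T : 2 / T ≤ 2 := div_le_self (by norm_num) hT1
      rw [e]
      refine (norm_sub_le _ _).trans ?_
      rw [hzn]
      have := norm_sub_le (V 1 : ℂ) (E₀ : ℂ)
      simp only [Complex.norm_real, Real.norm_eq_abs] at this
      linarith
    calc (1 : ℝ) = ‖u 0 + u 2 + ((V 1 : ℂ) - z) * u 1‖ := by rw [h]; simp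
      _ ≤ ‖u 0‖ + ‖u 2‖ + ‖(V 1 : ℂ) - z‖ * ‖u 1‖ := by
        refine (norm_add_le _ _).trans ?_
        rw [norm_mul]
        gcongr
        exact norm_add_le _ _
      _ ≤ _ := by gcongr
  have e2 : ‖u 2‖ ≤ vecNorm (cauchyData u 1) := norm_left_le_vecNorm _ _
  have e1 : ‖u 1‖ ≤ vecNorm (cauchyData u 1) := norm_right_le_vecNorm _ _
  have e0 : ‖u 0‖ ≤ vecNorm (cauchyData u 0) := norm_right_le_vecNorm _ _
  have hKe : K * ‖u 1‖ ≤ K * vecNorm (cauchyData u 1) := by gcongr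
  -- Either the data at 1 are large and propagate right through `[1, 2M]`, or `u(0)` is large and
  -- they propagate left through `[-2M, 0]`. On the half-line `u(0) = 0`, which rules out the second
  -- case.
  by_cases hR : c₀ ≤ vecNorm (cauchyData u 1)
  · have hIcc : ∀ n : ℤ, 1 ≤ n → n ∈ S := fun n hn => by rcases hS with rfl | rfl <;> simp [hn]
    refine ⟨Finset.Icc (M : ℤ) (M + M), fun m hm => ?_, hfinal _ ?_⟩
    · rw [Finset.mem_Icc] at hm
      refine ⟨hIcc m (by omega), le_trans ?_ (le_abs_self _)⟩
      exact_mod_cast hm.1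
    · refine le_sum_norm_sq u M M (by positivity) fun n hn => ?_
      rw [Finset.mem_Ico] at hn
      refine hprop 1 (2 * M) (fun n hn => ?_) (by omega) (by simp) 1
        (Finset.mem_Icc.2 (by omega)) hR n (Finset.mem_Icc.2 (by omega))
      rw [Finset.mem_Icc] at hn
      exact ⟨hIcc n hn.1, abs_le.2 (by omega)⟩
  · have hL : c₀ ≤ vecNorm (cauchyData u 0) ∧ 0 ∈ S := by
      have hc1 : (K + 1) * c₀ = 1 / 2 := by rw [hc₀]; field_simp
      have hlt : (K + 1) * vecNorm (cauchyData u 1) < 1 / 2 := by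
        rw [← hc1]
        exact mul_lt_mul_of_pos_left (not_le.1 hR) (by positivity)
      have h0 : 1 / 2 ≤ ‖u 0‖ := by linarith
      refine ⟨?_, ?_⟩
      · have : c₀ ≤ 1 / 2 := by rw [← hc1]; nlinarith
        linarith
      · by_contra h
        have hu0 : u 0 = 0 := laplaceAmplitude_of_notMem S V w h
        rw [hu0, norm_zero] at h0
        norm_num at h0
    have hSu : S = Set.univ := hS.resolve_right fun h => by
      have := hL.2
      rw [h] at this
      simp at this
    refine ⟨Finset.Icc (-(2 * M) : ℤ) (-(2 * M) + M), fun m hm => ?_, hfinal _ ?_⟩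
    · rw [Finset.mem_Icc] at hm
      refine ⟨by simp [hSu], le_trans ?_ (neg_le_abs _)⟩
      have : (M : ℤ) ≤ -m := by omega
      exact_mod_cast this
    · refine le_sum_norm_sq u (-(2 * M)) M (by positivity) fun n hn => ?_
      rw [Finset.mem_Ico] at hn
      refine hprop (-(2 * M)) 0 (fun n hn => ?_) (by omega) (by simp) 0
        (Finset.mem_Icc.2 (by omega)) hL.1 n (Finset.mem_Icc.2 (by omega))
      rw [Finset.mem_Icc] at hn
      exact ⟨by simp [hSu], abs_le.2 (by omega)⟩

/-! ### Choice of the scale and the growth exponent -/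

/-- The block estimate is applied at essentially the largest scale allowed: `M` is the integer part
of the `X` solving `8 D X^{1+α} = T`. -/
theorem exists_rpow_le_moment (S : Set ℤ) (hS : S = Set.univ ∨ S = Set.Ici 1) (V : ℤ → ℝ)
    (E₀ α C : ℝ) (hα : 0 ≤ α)
    (hT : ∀ n ∈ S, ∀ m ∈ S, (n ≠ 0 ∨ m ≠ 0) →
      matNorm (transfer V n m (E₀ : ℂ)) ≤ C * (|(n : ℝ)| + |(m : ℝ)|) ^ α)
    (p : ℝ) (hp : 0 < p) :
    ∃ k > 0, ∀ᶠ T : ℝ in atTop,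
      ENNReal.ofReal (k * T ^ ((p - 1 - 4 * α) / (1 + α))) ≤ moment S V p T := by
  obtain ⟨D, hD, c, hc, H⟩ := exists_block_le_sum S hS V E₀ α C hα hT
  have hα1 : 0 < 1 + α := by linarith
  set κ : ℝ := (8 * D) ^ (-1 / (1 + α)) with hκ
  have hκ0 : 0 < κ := by positivity
  refine ⟨2 * c * (1 / 2) ^ (p + 1) * κ ^ (p + 1 - 2 * α), by positivity, ?_⟩
  filter_upwards [eventually_ge_atTop 1, eventually_ge_atTop (8 * D)] with T hT1 hT8
  have hT0 : 0 < T := by linarith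
  set X : ℝ := κ * T ^ (1 / (1 + α)) with hX
  have hX0 : 0 < X := by positivity
  have hXpow : 8 * D * X ^ (1 + α) = T := by
    rw [hX, hκ, Real.mul_rpow (by positivity) (by positivity), ← Real.rpow_mul (by positivity),
      ← Real.rpow_mul (by positivity), div_mul_cancel₀ _ hα1.ne', div_mul_cancel₀ _ hα1.ne',
      Real.rpow_neg_one, Real.rpow_one]
    field_simp
  have hX1 : 1 ≤ X := by
    by_contra h
    have := Real.rpow_lt_one hX0.le (not_le.1 h) hα1
    nlinarith
  set M := ⌊X⌋₊
  have hM : 1 ≤ M := Nat.one_le_floor_iff _ |>.2 hX1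
  have hM1 : (1 : ℝ) ≤ M := by exact_mod_cast hM
  have hMX : (M : ℝ) ≤ X := Nat.floor_le hX0.le
  have hXM : 1 / 2 * X ≤ M := by
    have := Nat.lt_floor_add_one X
    have : X < M + 1 := this
    -- From `X < M + 1` and `1 ≤ M` follows `X < 2M`.
    linarith
  obtain ⟨F, hF, hsum⟩ := H T hT1 M hM (by
    rw [← hXpow]; gcongr) (((2 / T : ℝ) : ℂ) - Complex.I * E₀) rfl
  refine le_trans (ENNReal.ofReal_le_ofReal ?_) (le_moment S V hp hT0 (Nat.cast_nonneg M)
    (((2 / T : ℝ) : ℂ) - Complex.I * E₀) (by simp) F hF)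
  -- The numerator uses `M ≥ X/2` and the denominator `M ≤ X`. Keeping them apart avoids any
  -- condition on the sign of `p + 1 - 2α`.
  calc 2 * c * (1 / 2) ^ (p + 1) * κ ^ (p + 1 - 2 * α) * T ^ ((p - 1 - 4 * α) / (1 + α))
      = (2 / T ^ 2) * (c * ((1 / 2 * X) ^ (p + 1) / (X ^ α) ^ 2)) := by
        have e1 : (X ^ α) ^ 2 = X ^ (2 * α) := by
          rw [← Real.rpow_natCast, ← Real.rpow_mul hX0.le]; congr 1; push_cast; ring
        have e2 : (p - 1 - 4 * α) / (1 + α) = 1 / (1 + α) * (p + 1 - 2 * α) - 2 := by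
          field_simp; ring
        rw [e1, Real.mul_rpow (by norm_num) hX0.le, mul_div_assoc, ← Real.rpow_sub hX0, e2,
          Real.rpow_sub hT0, hX, Real.mul_rpow (by positivity) (by positivity),
          ← Real.rpow_mul hT0.le, Real.rpow_two]
        ring
    _ ≤ (2 / T ^ 2) * (c * ((M : ℝ) ^ (p + 1) / ((M : ℝ) ^ α) ^ 2)) := by gcongr
    _ = (M : ℝ) ^ p * (2 / T ^ 2) * (c * (M / ((M : ℝ) ^ α) ^ 2)) := by
        rw [Real.rpow_add (by linarith), Real.rpow_one]; ring
    _ ≤ _ := by gcongr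

/-- A power lower bound for a function gives a lower bound for its growth exponent. -/
theorem le_liminf_log_div_log {f : ℝ → ENNReal} {k γ : ℝ} (hk : 0 < k)
    (h : ∀ᶠ T : ℝ in atTop, ENNReal.ofReal (k * T ^ γ) ≤ f T) :
    (γ : EReal) ≤ liminf (fun T : ℝ => ENNReal.log (f T) / ((Real.log T : ℝ) : EReal)) atTop := by
  -- The prefactor `k` contributes `log k / log T`, which vanishes in the limit. The comparison
  -- function is real-valued, so infinite values of `f` need no separate case.
  have h1 : Tendsto (fun T : ℝ => ((γ + Real.log k / Real.log T : ℝ) : EReal)) atTop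
      (𝓝 (γ : EReal)) := by
    refine (continuous_coe_real_ereal.tendsto γ).comp ?_
    simpa using (tendsto_const_nhds (x := γ)).add
      (tendsto_const_nhds.div_atTop (a := Real.log k) Real.tendsto_log_atTop)
  rw [← h1.liminf_eq]
  refine liminf_le_liminf ?_
  filter_upwards [h, eventually_gt_atTop 1] with T hfT hT1
  have hT0 : 0 < T := by linarith
  have hlog : 0 < Real.log T := Real.log_pos hT1
  have h2 : γ + Real.log k / Real.log T = Real.log (k * T ^ γ) / Real.log T := by
    rw [Real.log_mul hk.ne' (by positivity), Real.log_rpow hT0]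
    field_simp
    ring
  rw [h2, EReal.coe_div]
  refine EReal.div_le_div_right_of_nonneg (by exact_mod_cast hlog.le) ?_
  rw [← ENNReal.log_ofReal_of_pos (by positivity)]
  exact ENNReal.log_monotone hfT

end OneEnergy

theorem corollary1 (S : Set ℤ) (hS : S = Set.univ ∨ S = Set.Ici 1) (V : ℤ → ℝ)
    (E₀ α C : ℝ) (hα : 0 ≤ α)
    (hT : ∀ n ∈ S, ∀ m ∈ S, (n ≠ 0 ∨ m ≠ 0) →
      OneEnergy.matNorm (OneEnergy.transfer V n m (E₀ : ℂ)) ≤ C * (|(n : ℝ)| + |(m : ℝ)|) ^ α)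
    (p : ℝ) (hp : 0 < p) :
    (((p - 1 - 4 * α) / (1 + α) : ℝ) : EReal) ≤ OneEnergy.betaMinus S V p := by
  obtain ⟨k, hk, h⟩ := OneEnergy.exists_rpow_le_moment S hS V E₀ α C hα hT p hp
  exact OneEnergy.le_liminf_log_div_log hk h
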